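/- Corollary 3.3 (Liouville's Theorem). Let $K$ be a simplicial 2-complex without boundary given by a triangulation of a domain in $\mathbb{C}$ (more generally, a triangulation without boundary of a connected oriented surface), oriented by the orientation of the domain. A *circle packing* for $K$ is a family $P=(C_P(v))_{v\in K^0}$ of circles in $\mathbb{C}$, indexed by the vertices of $K$, such that $C_P(u),C_P(v),C_P(w)$ is a positively oriented triple of mutually externally tangent circles whenever $\langle u,v,w\rangle$ is a positively oriented face of $K$; let $r_P(v)>0$ be the radius of $C_P(v)$. Let $S_P:K\to\mathbb{C}$ be the map of the geometric complex $K$ that sends each vertex $v$ to the center of $C_P(v)$ and is affine on edges and faces. The *carrier* of $P$ is $S_P(K)$, and $P$ is *univalent* if its circles have mutually disjoint interiors. For circle packings $P,Q$ for $K$, the *cp-map* $f$ with domain packing $P$ and range packing $Q$ sends the center of $C_P(v)$ to the center of $C_Q(v)$ for every vertex $v$ and is affine on the faces of the carrier of $P$; the associated *ratio map* $f^\#$ takes the value $r_Q(v)/r_P(v)$ at the center of $C_P(v)$ and is affine on the edges and faces of the carrier of $P$. (Both maps are regarded as functions on the geometric complex $K$, which for univalent $P$ is identified with the carrier through $S_P$.)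 Suppose that $P$ is a univalent circle packing for $K$ whose carrier is all of $\mathbb{C}$, and that the 1-skeleton of $K$ is recurrent, that is, the simple random walk on it, started at any vertex, visits every vertex infinitely many times with probability $1$. Then for every cp-map $f$ with domain packing $P$ (that is, for every circle packing $Q$ for $K$, branched or not), the ratio map $f^\#$ is either unbounded or constant. -/

import Mathlib

open MeasureTheory ProbabilityTheory Filter

/-- A triangulation (simplicial 2-complex) without boundary of a connected oriented surface, with
vertex set `V`. It is given by its positively oriented faces; every vertex and every edge lies in
a face, so these determine the complex. Every triangulation without boundary of a domain in `ℂ`,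
with the orientation induced from `ℂ`, is of this form. -/
structure OrientedTriangulation (V : Type*) where
  /-- `pos u v w` means that `⟨u, v, w⟩` is a face and the triple `(u, v, w)` is positively
  oriented. -/
  pos : V → V → V → Prop
  pos_rotate : ∀ u v w, pos u v w → pos v w u
  /-- The link of every vertex is a simplicial cycle `c 0, c 1, …, c (n - 1)` (so there are
  finitely many faces at each vertex), listed in the positive direction. -/
  link_cycle : ∀ v, ∃ n : ℕ, 3 ≤ n ∧ ∃ c : ZMod n → V, Function.Injective c ∧
    ∀ w x, pos v w x ↔ ∃ i, w = c i ∧ x = c (i + 1)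
  /-- The surface is connected: any two vertices are joined by an edge path. -/
  connected : ∀ u v, Relation.ReflTransGen (fun a b => ∃ x, pos a b x) u v

namespace OrientedTriangulation

variable {V : Type*}

theorem pos_pred (K : OrientedTriangulation V) {u v w : V} (h : K.pos u v w) :
    ∃ x, K.pos v u x := by
  obtain ⟨n, -, c, -, hcyc⟩ := K.link_cycle u
  obtain ⟨i, hv, -⟩ := (hcyc v w).1 h
  refine ⟨c (i - 1), K.pos_rotate _ _ _ ((hcyc (c (i - 1)) v).2 ⟨i - 1, rfl, ?_⟩) |>
    K.pos_rotate _ _ _⟩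
  rw [hv, sub_add_cancel]

theorem pos_ne (K : OrientedTriangulation V) {u v w : V} (h : K.pos u v w) : v ≠ w := by
  obtain ⟨n, hn, c, hc, hcyc⟩ := K.link_cycle u
  obtain ⟨i, rfl, rfl⟩ := (hcyc v w).1 h
  have : Fact (1 < n) := ⟨by omega⟩
  intro h
  simpa using hc h

/-- The 1-skeleton of the triangulation. -/
def skeleton (K : OrientedTriangulation V) : SimpleGraph V where
  Adj u v := ∃ w, K.pos u v w
  symm := ⟨fun _ _ ⟨_, h⟩ => K.pos_pred h⟩
  loopless := ⟨fun _ ⟨_, h⟩ => K.pos_ne (K.pos_rotate _ _ _ (K.pos_rotate _ _ _ h)) rfl⟩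

theorem neighborSet_finite (K : OrientedTriangulation V) (v : V) :
    (K.skeleton.neighborSet v).Finite := by
  obtain ⟨n, hn, c, -, hcyc⟩ := K.link_cycle v
  have : NeZero n := ⟨by omega⟩
  refine (Set.finite_range c).subset ?_
  rintro w ⟨x, h⟩
  obtain ⟨i, rfl, -⟩ := (hcyc w x).1 h
  exact ⟨i, rfl⟩

theorem neighborSet_nonempty (K : OrientedTriangulation V) (v : V) :
    (K.skeleton.neighborSet v).Nonempty := by
  obtain ⟨n, -, c, -, hcyc⟩ := K.link_cycle v
  exact ⟨c 0, c (0 + 1), (hcyc _ _).2 ⟨0, rfl, rfl⟩⟩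

section Walk

variable [MeasurableSpace V] [DiscreteMeasurableSpace V]

/-- One step of the simple random walk on the 1-skeleton: from `v`, jump to a neighbour of `v`
chosen uniformly at random. -/
noncomputable def step (K : OrientedTriangulation V) : Kernel V V where
  toFun v := uniformOn (K.skeleton.neighborSet v)
  measurable' := Measurable.of_discrete

instance (K : OrientedTriangulation V) : IsMarkovKernel K.step :=
  ⟨fun v => isProbabilityMeasure_uniformOn (K.neighborSet_finite v) (K.neighborSet_nonempty v)⟩

/-- The law, on the space `ℕ → V` of trajectories, of the simple random walk on the 1-skeleton
started at `v`. -/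
noncomputable def walk (K : OrientedTriangulation V) (v : V) : Measure (ℕ → V) :=
  Kernel.traj (X := fun _ => V)
    (fun n => K.step.comap (fun x : (i : Finset.Iic n) → V => x ⟨n, Finset.mem_Iic.2 le_rfl⟩)
      (measurable_pi_apply _)) 0 (fun _ => v)

end Walk

/-- The 1-skeleton is recurrent: from every starting vertex, the simple random walk visits every
vertex infinitely many times with probability one. -/
def Recurrent (K : OrientedTriangulation V) : Prop :=
  letI : MeasurableSpace V := ⊤
  haveI : DiscreteMeasurableSpace V := ⟨fun _ => MeasurableSpace.measurableSet_top⟩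
  ∀ v, ∀ᵐ ω ∂(K.walk v), ∀ w, ∃ᶠ n in atTop, ω n = w

/-- The geometric realization of the triangulation: the points given by nonnegative barycentric
coordinates of sum one that are supported in a face. -/
def Realization (K : OrientedTriangulation V) : Type _ :=
  {t : V →₀ ℝ // (∀ v, 0 ≤ t v) ∧ (t.sum fun _ a => a) = 1 ∧
    ∃ u v w, K.pos u v w ∧ (t.support : Set V) ⊆ {u, v, w}}

end OrientedTriangulation

/-- A circle packing for `K`: a family of circles indexed by the vertices such that positively
oriented faces correspond to positively oriented triples of mutually externally tangent circles.
Circles of different vertices may overlap or coincide (branched packings are allowed). -/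
structure CirclePacking {V : Type*} (K : OrientedTriangulation V) where
  center : V → ℂ
  radius : V → ℝ
  radius_pos : ∀ v, 0 < radius v
  /-- As `K.pos` is invariant under rotation, this covers all three pairs of circles of a face. -/
  tangent : ∀ u v w, K.pos u v w → dist (center u) (center v) = radius u + radius v
  /-- The centers of a positively oriented face are in counterclockwise order. -/
  oriented : ∀ u v w, K.pos u v w →
    0 < ((starRingEnd ℂ) (center v - center u) * (center w - center u)).im

namespace CirclePacking

variable {V : Type*} {K : OrientedTriangulation V}

/-- The packing is univalent: its circles have mutually disjoint interiors. -/
def Univalent (P : CirclePacking K) : Prop :=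
  ∀ u v, u ≠ v →
    Disjoint (Metric.ball (P.center u) (P.radius u)) (Metric.ball (P.center v) (P.radius v))

/-- The map from the geometric realization to the plane which sends each vertex `v` to the center
of its circle and is affine on edges and faces. -/
noncomputable def place (P : CirclePacking K) (x : K.Realization) : ℂ :=
  x.1.sum fun v a => (a : ℂ) * P.center v

/-- The carrier of the packing, as a subset of the plane. -/
def carrier (P : CirclePacking K) : Set ℂ := Set.range P.place

/-- The ratio map from `P` to `Q`, i.e. the ratio map associated with the circle packing map from
`P` to `Q`: its value at a vertex `v` is the ratio of the radius of `v` in `Q` to the radius of `v`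
in `P`, and it is affine on edges and faces. It is regarded as a function on the geometric complex
underlying `P`; for univalent `P` this is the carrier in the plane, through `P.place`. -/
noncomputable def ratioMap (P Q : CirclePacking K) (x : K.Realization) : ℝ :=
  x.1.sum fun v a => a * (Q.radius v / P.radius v)

end CirclePacking

/-!
The ratio of the radii of `Q` and `P` is subharmonic for the network on the 1-skeleton in which the
conductance of an edge is the length of its dual edge, joining incentres, divided by its own length.
Indeed, the angle of a face at a vertex lies below its tangent plane as a function of the radii
relative to `P`, while the angle sum at a vertex is at most `2π` for `P` and at least `2π` for `Q`.

Recurrence makes the network with unit conductances parabolic, by means of its Green function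
truncated in time and normalised. The conductances above are at most one, so by Rayleigh
monotonicity their network is parabolic too. On a parabolic network a positive superharmonic
function `u` is constant, by Picone's identity: the energy of a finitely supported `φ` dominates
that of `φ / u` for the conductances weighted by the values of `u` at the two ends. If the ratio of
the radii is bounded by `M`, this applies to `M + 1` minus that ratio.
-/

/-! ### Networks -/

/-- A locally finite electrical network on the vertex set `V`. Edges are not recorded separately:
two vertices are joined by an edge when their conductance is positive. -/
structure Network (V : Type*) where
  conductance : V → V → ℝ
  symm : ∀ v w, conductance v w = conductance w v
  nonneg : ∀ v w, 0 ≤ conductance v w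
  finite : ∀ v, (conductance v).HasFiniteSupport

namespace Network

variable {V : Type*} (N : Network V)

/-- The Dirichlet energy of a potential. The sum is over ordered pairs, so every edge counts
twice. -/
noncomputable def energy (φ : V → ℝ) : ℝ :=
  ∑ᶠ e : V × V, N.conductance e.1 e.2 * (φ e.2 - φ e.1) ^ 2

/-- The network Laplacian, with the sign for which subharmonic functions have nonnegative
Laplacian. -/
noncomputable def laplacian (h : V → ℝ) (v : V) : ℝ :=
  ∑ᶠ w, N.conductance v w * (h w - h v)

theorem laplacian_const_sub (a : ℝ) (h : V → ℝ) (v : V) :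
    N.laplacian (fun w => a - h w) v = -N.laplacian h v := by
  rw [laplacian, laplacian, ← finsum_neg_distrib]
  exact finsum_congr fun w => by ring

/-- A network is parabolic if every vertex has capacity zero relative to infinity. -/
def IsParabolic : Prop :=
  ∀ o, ∀ ε > 0, ∃ φ : V → ℝ, φ.HasFiniteSupport ∧ φ o = 1 ∧ N.energy φ ≤ ε

theorem hasFiniteSupport_conductance_mul {φ : V → ℝ} (hφ : φ.HasFiniteSupport) {G : V × V → ℝ}
    (hG : ∀ e, φ e.1 = 0 → φ e.2 = 0 → G e = 0) :
    (fun e : V × V => N.conductance e.1 e.2 * G e).HasFiniteSupport := by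
  have hstar : (⋃ v ∈ φ.support, Prod.mk v '' (N.conductance v).support).Finite :=
    Set.Finite.biUnion hφ fun v _ => (N.finite v).image _
  refine (hstar.union (hstar.image Prod.swap)).subset fun e he => ?_
  have hc : N.conductance e.1 e.2 ≠ 0 := left_ne_zero_of_mul he
  by_cases h : φ e.1 = 0
  · refine Or.inr ⟨e.swap, Set.mem_biUnion (fun h' => right_ne_zero_of_mul he (hG e h h'))
      ⟨e.1, ?_, rfl⟩, rfl⟩
    rwa [Function.mem_support, N.symm]
  · exact Or.inl (Set.mem_biUnion h ⟨e.2, hc, rfl⟩)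

theorem finsum_conductance_mul_sub_mul_sub {g : V → ℝ} (hg : g.HasFiniteSupport) (h : V → ℝ) :
    ∑ᶠ e : V × V, N.conductance e.1 e.2 * ((g e.2 - g e.1) * (h e.2 - h e.1)) =
      -2 * ∑ᶠ v, g v * N.laplacian h v := by
  set F : V × V → ℝ := fun e => N.conductance e.1 e.2 * (g e.1 * (h e.2 - h e.1)) with hF
  have hfin : F.HasFiniteSupport :=
    N.hasFiniteSupport_conductance_mul hg fun e h₁ _ => by rw [h₁, zero_mul]
  have hswap : ∑ᶠ e : V × V, F e.swap = ∑ᶠ e, F e := finsum_comp_equiv (Equiv.prodComm V V)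
  have hcurry : ∑ᶠ e, F e = ∑ᶠ v, g v * N.laplacian h v := by
    rw [finsum_curry F hfin]
    refine finsum_congr fun v => ?_
    rw [laplacian, mul_finsum]
    exact finsum_congr fun w => by simp only [hF]; ring
  have hsplit : ∀ e : V × V, N.conductance e.1 e.2 * ((g e.2 - g e.1) * (h e.2 - h e.1)) =
      -(F e.swap + F e) := fun e => by
    simp only [hF, Prod.fst_swap, Prod.snd_swap, N.symm e.2 e.1]; ring
  have hfin' : (fun e : V × V => F e.swap).HasFiniteSupport :=
    hfin.comp_of_injective Prod.swap_injective
  rw [finsum_congr hsplit, finsum_neg_distrib, finsum_add_distrib hfin' hfin, hswap, hcurry]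
  ring

theorem hasFiniteSupport_energy {φ : V → ℝ} (hφ : φ.HasFiniteSupport) :
    (fun e : V × V => N.conductance e.1 e.2 * (φ e.2 - φ e.1) ^ 2).HasFiniteSupport :=
  N.hasFiniteSupport_conductance_mul hφ fun e h₁ h₂ => by rw [h₁, h₂]; ring

theorem conductance_mul_sq_le_energy {φ : V → ℝ} (hφ : φ.HasFiniteSupport) (v w : V) :
    N.conductance v w * (φ w - φ v) ^ 2 ≤ N.energy φ :=
  single_le_finsum (v, w) (N.hasFiniteSupport_energy hφ)
    fun _ => mul_nonneg (N.nonneg _ _) (sq_nonneg _)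

variable {N}

theorem IsParabolic.mono {N' : Network V} (hN : N.IsParabolic)
    (hle : ∀ v w, N'.conductance v w ≤ N.conductance v w) : N'.IsParabolic := fun o ε hε => by
  obtain ⟨φ, hφ, ho, hE⟩ := hN o ε hε
  exact ⟨φ, hφ, ho, (finsum_le_finsum' (N'.hasFiniteSupport_energy hφ)
    (N.hasFiniteSupport_energy hφ) fun e => mul_le_mul_of_nonneg_right (hle _ _)
      (sq_nonneg _)).trans hE⟩

theorem picone_identity {a b : ℝ} (ha : a ≠ 0) (hb : b ≠ 0) (p q : ℝ) :
    (q ^ 2 / b - p ^ 2 / a) * (b - a) = (q - p) ^ 2 - (q * a - p * b) ^ 2 / (a * b) := by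
  field_simp
  ring

theorem conductance_mul_sq_div_le_energy {φ u : V → ℝ} (hφ : φ.HasFiniteSupport)
    (hu : ∀ v, 0 < u v) (hsup : ∀ v, N.laplacian u v ≤ 0) (v w : V) :
    N.conductance v w * ((φ w * u v - φ v * u w) ^ 2 / (u v * u w)) ≤ N.energy φ := by
  have hfin : (fun e : V × V => N.conductance e.1 e.2 *
      ((φ e.2 * u e.1 - φ e.1 * u e.2) ^ 2 / (u e.1 * u e.2))).HasFiniteSupport :=
    N.hasFiniteSupport_conductance_mul hφ fun e h₁ h₂ => by rw [h₁, h₂]; ring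
  have hg : (fun v => φ v ^ 2 / u v).HasFiniteSupport :=
    hφ.subset fun v hv h => hv (by simp [h])
  have hgreen := N.finsum_conductance_mul_sub_mul_sub hg u
  simp_rw [picone_identity (hu _).ne' (hu _).ne', mul_sub] at hgreen
  rw [finsum_sub_distrib (N.hasFiniteSupport_energy hφ) hfin, ← energy] at hgreen
  have hneg : ∑ᶠ v, φ v ^ 2 / u v * N.laplacian u v ≤ 0 := by
    rw [← neg_nonneg, ← finsum_neg_distrib]
    exact finsum_nonneg fun v => neg_nonneg.2 <| mul_nonpos_of_nonneg_of_nonpos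
      (div_nonneg (sq_nonneg _) (hu v).le) (hsup v)
  refine (single_le_finsum (v, w) hfin fun e => mul_nonneg (N.nonneg _ _)
    (div_nonneg (sq_nonneg _) (mul_pos (hu _) (hu _)).le)).trans ?_
  linarith

theorem IsParabolic.eq_of_superharmonic (hN : N.IsParabolic) {u : V → ℝ} (hu : ∀ v, 0 < u v)
    (hsup : ∀ v, N.laplacian u v ≤ 0) {v w : V} (hvw : 0 < N.conductance v w) : u v = u w := by
  have hbound : ∀ ε > 0, (u v - u w) ^ 2 ≤ ε := fun ε hε => by
    have hden : 0 < 2 * (u v ^ 2 + u v * u w) := by have := hu v; have := hu w; positivity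
    set δ := ε * N.conductance v w / (2 * (u v ^ 2 + u v * u w))
    have hδ : δ * (2 * (u v ^ 2 + u v * u w)) = ε * N.conductance v w :=
      div_mul_cancel₀ _ hden.ne'
    obtain ⟨φ, hφ, hv, hE⟩ := hN v δ (by positivity)
    have h₁ := (N.conductance_mul_sq_le_energy hφ v w).trans hE
    have h₂ := (conductance_mul_sq_div_le_energy hφ hu hsup v w).trans hE
    rw [hv, one_mul, ← mul_div_assoc, div_le_iff₀ (mul_pos (hu v) (hu w))] at h₂
    rw [hv] at h₁
    refine le_of_mul_le_mul_left ?_ hvw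
    calc N.conductance v w * (u v - u w) ^ 2
        ≤ N.conductance v w *
            (2 * u v ^ 2 * (φ w - 1) ^ 2 + 2 * (φ w * u v - u w) ^ 2) := by
          gcongr
          linarith [sq_nonneg ((φ w - 1) * u v + (φ w * u v - u w))]
      _ = 2 * u v ^ 2 * (N.conductance v w * (φ w - 1) ^ 2) +
            2 * (N.conductance v w * (φ w * u v - u w) ^ 2) := by ring
      _ ≤ 2 * u v ^ 2 * δ + 2 * (δ * (u v * u w)) := by gcongr
      _ = N.conductance v w * ε := by linarith
  have : (u v - u w) ^ 2 = 0 := le_antisymm (le_of_forall_pos_le_add fun ε hε => by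
    simpa using hbound ε hε) (sq_nonneg _)
  exact sub_eq_zero.1 (pow_eq_zero_iff two_ne_zero |>.1 this)

section RandomWalk

variable (N)

/-- The total conductance at a vertex. -/
noncomputable def degree (v : V) : ℝ := ∑ᶠ w, N.conductance v w

/-- The transition operator of the random walk on the network, acting on functions by weighted
averages over the neighbours. At an isolated vertex the average is `0`. -/
noncomputable def average : Module.End ℝ (V → ℝ) where
  toFun h v := (∑ᶠ w, N.conductance v w * h w) / N.degree v
  map_add' g h := funext fun v => by
    have := N.finite v
    simp only [Pi.add_apply, mul_add]
    rw [finsum_add_distrib (by fun_prop) (by fun_prop), add_div]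
  map_smul' a h := funext fun v => by
    simp only [Pi.smul_apply, smul_eq_mul, RingHom.id_apply, mul_left_comm _ a]
    rw [← mul_finsum, mul_div_assoc]

theorem degree_nonneg (v : V) : 0 ≤ N.degree v := finsum_nonneg (N.nonneg v)

theorem conductance_le_degree (v w : V) : N.conductance v w ≤ N.degree v :=
  single_le_finsum w (N.finite v) (N.nonneg v)

theorem degree_mul_sub_average (h : V → ℝ) (v : V) :
    N.degree v * (h v - N.average h v) = -N.laplacian h v := by
  have hfin := N.finite v
  have hzero : N.degree v = 0 → ∑ᶠ w, N.conductance v w * h w = 0 := fun hd => by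
    have hc : ∀ w, N.conductance v w = 0 := fun w =>
      le_antisymm (hd ▸ N.conductance_le_degree v w) (N.nonneg v w)
    simp only [hc, zero_mul, finsum_zero]
  simp only [laplacian, mul_sub]
  rw [finsum_sub_distrib (by fun_prop) (by fun_prop), ← finsum_mul, ← degree]
  change _ - N.degree v * ((∑ᶠ w, N.conductance v w * h w) / N.degree v) = _
  rw [mul_div_cancel_of_imp' hzero]
  ring

theorem average_nonneg {h : V → ℝ} (hh : 0 ≤ h) : 0 ≤ N.average h := fun v =>
  div_nonneg (finsum_nonneg fun w => mul_nonneg (N.nonneg v w) (hh w)) (N.degree_nonneg v)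

theorem average_pow_nonneg {h : V → ℝ} (hh : 0 ≤ h) (n : ℕ) : 0 ≤ (N.average ^ n) h := by
  induction n with
  | zero => exact hh
  | succ n ih => rw [pow_succ']; exact N.average_nonneg ih

theorem hasFiniteSupport_average {h : V → ℝ} (hh : h.HasFiniteSupport) :
    (N.average h).HasFiniteSupport := by
  refine (Set.Finite.biUnion hh fun w _ => N.finite w).subset fun v hv => ?_
  obtain ⟨w, hw⟩ : ∃ w, N.conductance v w * h w ≠ 0 := by
    by_contra! h0
    exact hv (by simp only [average, LinearMap.coe_mk, AddHom.coe_mk, h0, finsum_zero, zero_div])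
  refine Set.mem_biUnion (right_ne_zero_of_mul hw) ?_
  rw [Function.mem_support, N.symm]
  exact left_ne_zero_of_mul hw

theorem hasFiniteSupport_average_pow {h : V → ℝ} (hh : h.HasFiniteSupport) (n : ℕ) :
    ((N.average ^ n) h).HasFiniteSupport := by
  induction n with
  | zero => exact hh
  | succ n ih => rw [pow_succ']; exact N.hasFiniteSupport_average ih

theorem energy_eq_finsum_degree_mul_sub_average {φ : V → ℝ} (hφ : φ.HasFiniteSupport) :
    N.energy φ = 2 * ∑ᶠ v, φ v * (N.degree v * (φ v - N.average φ v)) := by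
  simp only [degree_mul_sub_average, mul_neg, finsum_neg_distrib]
  rw [← neg_mul, ← N.finsum_conductance_mul_sub_mul_sub hφ φ]
  simp only [energy, pow_two]

theorem energy_smul (a : ℝ) (φ : V → ℝ) : N.energy (a • φ) = a ^ 2 * N.energy φ := by
  rw [energy, energy, mul_finsum]
  exact finsum_congr fun e => by simp only [Pi.smul_apply, smul_eq_mul]; ring

variable [DecidableEq V]

/-- The expected numbers of visits to `o` in the first `n` steps, as a function of the starting
vertex of the random walk. -/
noncomputable def truncatedGreen (o : V) (n : ℕ) : V → ℝ :=
  ∑ k ∈ Finset.range n, (N.average ^ k) (Pi.single o 1)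

theorem average_pow_single_nonneg (o : V) (n : ℕ) : 0 ≤ (N.average ^ n) (Pi.single o 1) :=
  N.average_pow_nonneg (Pi.single_nonneg.2 zero_le_one) n

theorem truncatedGreen_nonneg (o : V) (n : ℕ) : 0 ≤ N.truncatedGreen o n :=
  Finset.sum_nonneg fun k _ => N.average_pow_single_nonneg o k

theorem hasFiniteSupport_truncatedGreen (o : V) (n : ℕ) :
    (N.truncatedGreen o n).HasFiniteSupport := by
  have hpow := fun k => N.hasFiniteSupport_average_pow
    ((Set.finite_singleton o).subset (Pi.support_single_subset (a := (1 : ℝ)))) k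
  rw [truncatedGreen, Finset.sum_fn]
  fun_prop

theorem truncatedGreen_sub_average_le (o : V) (n : ℕ) :
    N.truncatedGreen o n - N.average (N.truncatedGreen o n) ≤ Pi.single o 1 := by
  have hdiff : N.truncatedGreen o n - N.average (N.truncatedGreen o n) =
      Pi.single o 1 - (N.average ^ n) (Pi.single o 1) := by
    simpa [sub_mul, truncatedGreen] using
      LinearMap.congr_fun (mul_neg_geom_sum N.average n) (Pi.single o (1 : ℝ))
  exact hdiff ▸ sub_le_self _ (N.average_pow_single_nonneg o n)

theorem energy_truncatedGreen_le (o : V) (n : ℕ) :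
    N.energy (N.truncatedGreen o n) ≤ 2 * (N.degree o * N.truncatedGreen o n o) := by
  have hfin := N.hasFiniteSupport_truncatedGreen o n
  rw [N.energy_eq_finsum_degree_mul_sub_average hfin]
  gcongr
  calc ∑ᶠ v, N.truncatedGreen o n v *
        (N.degree v * (N.truncatedGreen o n v - N.average (N.truncatedGreen o n) v))
      ≤ ∑ᶠ v, N.truncatedGreen o n v * (N.degree v * (Pi.single o 1 : V → ℝ) v) := by
        refine finsum_le_finsum' (by fun_prop) (by fun_prop) fun v => ?_
        exact mul_le_mul_of_nonneg_left (mul_le_mul_of_nonneg_left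
          (N.truncatedGreen_sub_average_le o n v) (N.degree_nonneg v))
          (N.truncatedGreen_nonneg o n v)
    _ = N.degree o * N.truncatedGreen o n o := by
        rw [finsum_eq_single _ o fun v hv => by rw [Pi.single_eq_of_ne hv, mul_zero, mul_zero],
          Pi.single_eq_same, mul_one, mul_comm]

theorem isParabolic_of_not_summable
    (hN : ∀ o, ¬Summable fun n => (N.average ^ n) (Pi.single o (1 : ℝ)) o) : N.IsParabolic := by
  intro o ε hε
  have hgreen : Tendsto (fun n => N.truncatedGreen o n o) atTop atTop := by
    simpa only [truncatedGreen, Finset.sum_apply] using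
      (not_summable_iff_tendsto_nat_atTop_of_nonneg
        fun n => N.average_pow_single_nonneg o n o).1 (hN o)
  obtain ⟨n, hn, hpos⟩ := ((hgreen.eventually_ge_atTop (2 * N.degree o / ε)).and
    (hgreen.eventually_gt_atTop 0)).exists
  refine ⟨(N.truncatedGreen o n o)⁻¹ • N.truncatedGreen o n,
    (N.hasFiniteSupport_truncatedGreen o n).subset (Function.support_const_smul_subset _ _),
    inv_mul_cancel₀ hpos.ne', ?_⟩
  rw [div_le_iff₀ hε] at hn
  calc N.energy ((N.truncatedGreen o n o)⁻¹ • N.truncatedGreen o n)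
      ≤ (N.truncatedGreen o n o)⁻¹ ^ 2 * (2 * (N.degree o * N.truncatedGreen o n o)) := by
        rw [energy_smul]
        gcongr
        exact N.energy_truncatedGreen_le o n
    _ = 2 * N.degree o / N.truncatedGreen o n o := by field_simp
    _ ≤ ε := by rwa [div_le_iff₀' hpos]

end RandomWalk

end Network

/-! ### Random walks -/

section MarkovChain

variable {α : Type*} [MeasurableSpace α] (κ : Kernel α α) [IsMarkovKernel κ]

/-- The law, on the space of trajectories, of the Markov chain with transition kernel `κ` started
at `x`. -/
noncomputable def markovChainLaw (x : α) : Measure (ℕ → α) :=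
  Kernel.traj (X := fun _ => α)
    (fun n => κ.comap (fun y : (i : Finset.Iic n) → α => y ⟨n, Finset.mem_Iic.2 le_rfl⟩)
      (measurable_pi_apply _)) 0 (fun _ => x)

instance (x : α) : IsProbabilityMeasure (markovChainLaw κ x) := by
  unfold markovChainLaw; infer_instance

theorem map_markovChainLaw (x : α) (n : ℕ) :
    (markovChainLaw κ x).map (fun ω => ω n) = (κ ^ n) x := by
  let last (n : ℕ) (y : (i : Finset.Iic n) → α) : α := y ⟨n, Finset.mem_Iic.2 le_rfl⟩
  have hlast : ∀ n, Measurable (last n) := fun n => measurable_pi_apply _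
  let κ' (n : ℕ) := κ.comap (last n) (hlast n)
  have hpartial : (Kernel.partialTraj (X := fun _ => α) κ' 0 n).map (last n) =
      (κ ^ n).comap (last 0) (hlast 0) := by
    induction n with
    | zero =>
      rw [Kernel.partialTraj_self]
      ext y : 1
      rw [Kernel.map_apply _ (hlast 0), Kernel.comap_apply, Kernel.id_apply,
        Measure.map_dirac' (hlast 0)]
      exact (Kernel.id_apply _).symm
    | succ n ih =>
      rw [Kernel.partialTraj_succ_eq_comp (Nat.zero_le n), Kernel.map_comp,
        Kernel.map_partialTraj_succ_self]
      change (κ.comap (last n) (hlast n)) ∘ₖ _ = _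
      rw [← Kernel.comp_map _ _ (hlast n), ih, pow_succ']
      rfl
  have hcomp : (fun ω : ℕ → α => ω n) = last n ∘ Preorder.frestrictLe n := rfl
  rw [hcomp, ← Measure.map_map (hlast n) (by fun_prop), markovChainLaw,
    Kernel.traj_map_frestrictLe_apply, ← Kernel.map_apply _ (hlast n)]
  exact DFunLike.congr_fun hpartial _

theorem tsum_pow_apply_eq_top {x : α} {s : Set α} (hs : MeasurableSet s)
    (hrec : ∀ᵐ ω ∂markovChainLaw κ x, ∃ᶠ n in atTop, ω n ∈ s) :
    ∑' n, (κ ^ n) x s = ⊤ := by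
  by_contra hsum
  have hzero : markovChainLaw κ x {ω | ∃ᶠ n in atTop, ω n ∈ s} = 0 := by
    refine measure_setOfPred_frequently_eq_zero (p := fun n (ω : ℕ → α) => ω n ∈ s) ?_
    have happly : ∀ n, (κ ^ n) x s = markovChainLaw κ x {ω | ω n ∈ s} := fun n => by
      rw [← map_markovChainLaw, Measure.map_apply (measurable_pi_apply n) hs]
      rfl
    rwa [tsum_congr happly] at hsum
  obtain ⟨ω, hω, hω'⟩ := (hrec.and (measure_eq_zero_iff_ae_notMem.1 hzero)).exists
  exact hω' hω

end MarkovChain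

open Classical in
/-- The network on a locally finite graph in which every edge has conductance one. -/
noncomputable def Network.ofGraph {V : Type*} (G : SimpleGraph V)
    (hG : ∀ v, (G.neighborSet v).Finite) : Network V where
  conductance v w := if G.Adj v w then 1 else 0
  symm v w := by simp only [G.adj_comm]
  nonneg v w := by split_ifs <;> norm_num
  finite v := (hG v).subset fun w hw => by_contra fun h => hw (if_neg h)

namespace OrientedTriangulation

variable {V : Type*} (K : OrientedTriangulation V)

/-- The 1-skeleton with unit conductances. -/
noncomputable def skeletonNetwork : Network V :=
  Network.ofGraph K.skeleton K.neighborSet_finite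

theorem skeletonNetwork_average_apply (h : V → ℝ) (v : V) :
    K.skeletonNetwork.average h v =
      (∑ w ∈ (K.neighborSet_finite v).toFinset, h w) / (K.neighborSet_finite v).toFinset.card := by
  have hsum : ∀ g : V → ℝ, ∑ᶠ w, K.skeletonNetwork.conductance v w * g w =
      ∑ w ∈ (K.neighborSet_finite v).toFinset, g w := fun g => by
    rw [← finsum_mem_finset_eq_sum]
    refine finsum_congr fun w => ?_
    by_cases hw : K.skeleton.Adj v w <;> simp [skeletonNetwork, Network.ofGraph, hw]
  have hdeg : K.skeletonNetwork.degree v = (K.neighborSet_finite v).toFinset.card := by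
    simpa only [Network.degree, Pi.one_apply, mul_one, Finset.sum_const, nsmul_eq_mul] using hsum 1
  change _ / K.skeletonNetwork.degree v = _
  rw [hsum, hdeg]

section Walk

variable [MeasurableSpace V] [DiscreteMeasurableSpace V]

theorem lintegral_step {h : V → ℝ} (hh : 0 ≤ h) (v : V) :
    ∫⁻ w, ENNReal.ofReal (h w) ∂K.step v =
      ENNReal.ofReal (K.skeletonNetwork.average h v) := by
  set s := (K.neighborSet_finite v).toFinset with hs
  have hcard : 0 < s.card := by simpa [hs, Finset.card_pos] using K.neighborSet_nonempty v
  change ∫⁻ w, ENNReal.ofReal (h w) ∂(uniformOn (K.skeleton.neighborSet v)) = _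
  rw [skeletonNetwork_average_apply, ← hs, ← (K.neighborSet_finite v).coe_toFinset, ← hs,
    uniformOn, ProbabilityTheory.cond,
    lintegral_smul_measure, lintegral_finset, Measure.count_apply_finset,
    ENNReal.ofReal_div_of_pos (by exact_mod_cast hcard), ENNReal.ofReal_natCast,
    ENNReal.ofReal_sum_of_nonneg fun w _ => hh w, smul_eq_mul, ENNReal.div_eq_inv_mul]
  simp only [Measure.count_singleton, mul_one]

theorem lintegral_step_pow {h : V → ℝ} (hh : 0 ≤ h) (n : ℕ) (v : V) :
    ∫⁻ w, ENNReal.ofReal (h w) ∂(K.step ^ n) v =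
      ENNReal.ofReal ((K.skeletonNetwork.average ^ n) h v) := by
  induction n generalizing v with
  | zero =>
    exact Kernel.lintegral_id' (Measurable.of_discrete (f := fun w => ENNReal.ofReal (h w))) v
  | succ n ih =>
    rw [pow_succ, pow_succ']
    change ∫⁻ w, _ ∂((K.step ^ n) ∘ₖ K.step) v = _
    rw [Kernel.lintegral_comp _ _ _ Measurable.of_discrete, lintegral_congr ih,
      K.lintegral_step (K.skeletonNetwork.average_pow_nonneg hh n)]
    rfl

theorem step_pow_apply_singleton [DecidableEq V] (o : V) (n : ℕ) (v : V) :
    (K.step ^ n) v {o} =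
      ENNReal.ofReal ((K.skeletonNetwork.average ^ n) (Pi.single o 1) v) := by
  rw [← K.lintegral_step_pow (Pi.single_nonneg.2 zero_le_one),
    ← lintegral_indicator_one (MeasurableSet.of_discrete (s := {o}))]
  refine lintegral_congr fun w => ?_
  by_cases hw : w = o <;> simp [hw]

end Walk

theorem Recurrent.isParabolic {K : OrientedTriangulation V} (hK : K.Recurrent) :
    K.skeletonNetwork.IsParabolic := by
  classical
  let _ : MeasurableSpace V := ⊤
  have : DiscreteMeasurableSpace V := ⟨fun _ => MeasurableSpace.measurableSet_top⟩
  refine K.skeletonNetwork.isParabolic_of_not_summable fun o hsum => ?_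
  have hrec : ∀ᵐ ω ∂markovChainLaw K.step o, ∃ᶠ n in atTop, ω n ∈ ({o} : Set V) :=
    (hK o).mono fun ω hω => hω o
  refine hsum.tsum_ofReal_ne_top ?_
  rw [← tsum_pow_apply_eq_top K.step MeasurableSet.of_discrete hrec]
  exact tsum_congr fun n => (K.step_pow_apply_singleton o n o).symm

end OrientedTriangulation

/-! ### Triples of tangent circles -/

section FaceGeometry

theorem mul_nonpos_of_weighted_sum_eq_zero {x y z p q r : ℝ} (hx : 0 ≤ x) (hy : 0 ≤ y) (hz : 0 < z)
    (h : x * p + y * q + z * r = 0) : p * q ≤ 0 ∨ q * r ≤ 0 ∨ r * p ≤ 0 := by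
  by_contra! hpos
  obtain ⟨-, hqr, hrp⟩ := hpos
  have hr : 0 < r * r := mul_self_pos.2 fun h0 => by simp [h0] at hqr
  nlinarith [mul_nonneg hx hrp.le, mul_nonneg hy hqr.le, mul_pos hz hr, congrArg (· * r) h]

theorem four_mul_mul_mul_le_of_mul_nonpos {a b c t : ℝ} (ht : 0 ≤ t) (hc : 0 ≤ c)
    (h : (t - a) * (t - b) ≤ 0) : 4 * (a * b * c) ≤ t * (a + b + c - t) ^ 2 := by
  nlinarith [mul_nonneg ht (sq_nonneg (c - (a + b - t))), mul_nonneg hc (neg_nonneg.2 h)]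

theorem four_mul_mul_mul_le_of_weighted_mean {a b c x y z t : ℝ} (ha : 0 ≤ a) (hb : 0 ≤ b)
    (hc : 0 ≤ c) (hx : 0 ≤ x) (hy : 0 ≤ y) (hz : 0 < z) (ht : 0 ≤ t)
    (h : x * a + y * b + z * c = (x + y + z) * t) :
    4 * (a * b * c) ≤ t * (a + b + c - t) ^ 2 := by
  rcases mul_nonpos_of_weighted_sum_eq_zero (p := t - a) (q := t - b) (r := t - c) hx hy hz
    (by linarith) with hab | hbc | hca
  · exact four_mul_mul_mul_le_of_mul_nonpos ht hc hab
  · linarith [four_mul_mul_mul_le_of_mul_nonpos ht ha hbc]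
  · linarith [four_mul_mul_mul_le_of_mul_nonpos ht hb hca]

/-- The inradius of the triangle formed by the centres of mutually tangent circles of radii `r`,
`x`, `y`, by Heron's formula. -/
noncomputable def inradius (r x y : ℝ) : ℝ := √(r * x * y / (r + x + y))

/-- The angle at the centre of the circle of radius `r` in the triangle formed by the centres of
mutually tangent circles of radii `r`, `x`, `y`: the line to the incentre bisects it, and the
incircle touches the two sides at distance `r`. -/
noncomputable def faceAngle (r x y : ℝ) : ℝ := 2 * Real.arctan (inradius r x y / r)

/-- The inradius of the triangle formed by the centres of mutually tangent circles of radii `r`,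
`x`, `y`, relative to the length of its side between the first two. It is the contribution of this
face to the conductance of that edge. -/
noncomputable def edgeWeight (r x y : ℝ) : ℝ := inradius r x y / (r + x)

variable {r x y : ℝ}

theorem inradius_swap (r x y : ℝ) : inradius r y x = inradius r x y := by
  rw [inradius, inradius, mul_right_comm, add_right_comm]

theorem inradius_sq (hr : 0 < r) (hx : 0 < x) (hy : 0 < y) :
    inradius r x y ^ 2 = r * x * y / (r + x + y) := Real.sq_sqrt (by positivity)

theorem inradius_pos (hr : 0 < r) (hx : 0 < x) (hy : 0 < y) : 0 < inradius r x y := by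
  unfold inradius
  positivity

theorem edgeWeight_comm (r x y : ℝ) : edgeWeight r x y = edgeWeight x r y := by
  rw [edgeWeight, edgeWeight, inradius, inradius, mul_comm r x, add_comm r x]

theorem edgeWeight_pos (hr : 0 < r) (hx : 0 < x) (hy : 0 < y) : 0 < edgeWeight r x y :=
  div_pos (inradius_pos hr hx hy) (add_pos hr hx)

theorem edgeWeight_le_half (hr : 0 < r) (hx : 0 < x) (hy : 0 < y) :
    edgeWeight r x y ≤ 1 / 2 := by
  rw [edgeWeight, div_le_iff₀ (add_pos hr hx)]
  refine abs_le_of_sq_le_sq' ?_ (by positivity) |>.2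
  rw [inradius_sq hr hx hy, div_le_iff₀ (by positivity)]
  nlinarith [mul_nonneg hy.le (sq_nonneg (r - x)), pow_pos (add_pos hr hx) 3]

theorem inradius_le_tangent_plane {a b c : ℝ} (hr : 0 < r) (hx : 0 < x) (hy : 0 < y) (ha : 0 < a)
    (hb : 0 < b) (hc : 0 < c) : inradius (c * r) (a * x) (b * y) ≤
      inradius r x y * (((r + y) * a + (r + x) * b + (x + y) * c) / (2 * (r + x + y))) := by
  set s := r + x + y with hs
  have hs0 : 0 < s := by positivity
  set t := (x * a + y * b + r * c) / s
  have hts : s * t = x * a + y * b + r * c := mul_div_cancel₀ _ hs0.ne'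
  have ht0 : 0 < t := by positivity
  have hlin : (r + y) * a + (r + x) * b + (x + y) * c = s * (a + b + c - t) := by
    rw [mul_sub, hts, hs]; ring
  have key := four_mul_mul_mul_le_of_weighted_mean ha.le hb.le hc.le hx.le hy.le hr ht0.le
    (by rw [← hts, hs]; ring)
  refine abs_le_of_sq_le_sq' ?_ (by have := inradius_pos hr hx hy; positivity) |>.2
  rw [mul_pow, inradius_sq hr hx hy, inradius_sq (by positivity) (by positivity) (by positivity),
    hlin, show c * r + a * x + b * y = s * t by rw [hts]; ring]
  calc c * r * (a * x) * (b * y) / (s * t)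
      = r * x * y / (4 * s * t) * (4 * (a * b * c)) := by field_simp
    _ ≤ r * x * y / (4 * s * t) * (t * (a + b + c - t) ^ 2) := by gcongr
    _ = r * x * y / s * (s * (a + b + c - t) / (2 * s)) ^ 2 := by field_simp; ring

theorem concaveOn_arctan : ConcaveOn ℝ (Set.Ici 0) Real.arctan := by
  refine AntitoneOn.concaveOn_of_deriv (convex_Ici 0) Real.continuous_arctan.continuousOn
    Real.differentiable_arctan.differentiableOn fun s hs u _ hsu => ?_
  rw [interior_Ici, Set.mem_Ioi] at hs
  simp only [Real.deriv_arctan]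
  gcongr

theorem arctan_sub_arctan_le {s u : ℝ} (hs : 0 < s) (hu : 0 ≤ u) :
    Real.arctan u - Real.arctan s ≤ (u - s) / (1 + s ^ 2) := by
  have hderiv := Real.hasDerivAt_arctan s
  rcases lt_trichotomy s u with hsu | rfl | hus
  · have h := concaveOn_arctan.slope_le_of_hasDerivAt hs.le hu hsu hderiv
    rw [slope_def_field, div_le_iff₀ (sub_pos.2 hsu)] at h
    linarith [one_div_mul_eq_div (1 + s ^ 2) (u - s)]
  · simp
  · have h := concaveOn_arctan.le_slope_of_hasDerivAt hu hs.le hus hderiv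
    rw [slope_def_field, le_div_iff₀ (sub_pos.2 hus)] at h
    linarith [one_div_mul_eq_div (1 + s ^ 2) (u - s)]

theorem one_add_inradius_div_sq (hr : 0 < r) (hx : 0 < x) (hy : 0 < y) :
    1 + (inradius r x y / r) ^ 2 = (r + x) * (r + y) / (r * (r + x + y)) := by
  rw [div_pow, inradius_sq hr hx hy]
  field_simp
  ring

theorem mul_faceAngle_sub_le {a b c : ℝ} (hr : 0 < r) (hx : 0 < x) (hy : 0 < y)
    (ha : 0 < a) (hb : 0 < b) (hc : 0 < c) :
    c * (faceAngle (c * r) (a * x) (b * y) - faceAngle r x y) ≤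
      edgeWeight r x y * (a - c) + edgeWeight r y x * (b - c) := by
  have hρ := inradius_pos hr hx hy
  set τ := inradius r x y / r with hτ
  obtain ⟨k, hk⟩ : ∃ k, k = ((r + y) * a + (r + x) * b + (x + y) * c) / (2 * (r + x + y)) :=
    ⟨_, rfl⟩
  have hk0 : 0 < k := by rw [hk]; positivity
  have htangent : inradius (c * r) (a * x) (b * y) / (c * r) ≤ τ * k / c := by
    rw [div_le_iff₀ (by positivity), hτ]
    refine (inradius_le_tangent_plane hr hx hy ha hb hc).trans_eq ?_
    rw [← hk]
    field_simp
  calc c * (faceAngle (c * r) (a * x) (b * y) - faceAngle r x y)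
      ≤ c * (2 * ((τ * k / c - τ) / (1 + τ ^ 2))) := by
        rw [faceAngle, faceAngle, ← mul_sub]
        gcongr
        exact (sub_le_sub_right (Real.arctan_mono htangent) _).trans
          (arctan_sub_arctan_le (by positivity) (by positivity))
    _ = edgeWeight r x y * (a - c) + edgeWeight r y x * (b - c) := by
        rw [hτ, one_add_inradius_div_sq hr hx hy, edgeWeight, edgeWeight, inradius_swap, hk]
        field_simp
        ring

theorem faceAngle_pos (hr : 0 < r) (hx : 0 < x) (hy : 0 < y) : 0 < faceAngle r x y :=
  mul_pos two_pos (Real.arctan_pos.2 (div_pos (inradius_pos hr hx hy) hr))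

theorem faceAngle_lt_pi (r x y : ℝ) : faceAngle r x y < Real.pi := by
  have := Real.arctan_lt_pi_div_two (inradius r x y / r)
  unfold faceAngle
  linarith

theorem cos_faceAngle (hr : 0 < r) (hx : 0 < x) (hy : 0 < y) : Real.cos (faceAngle r x y) =
    ((r + x) ^ 2 + (r + y) ^ 2 - (x + y) ^ 2) / (2 * ((r + x) * (r + y))) := by
  rw [faceAngle, Real.cos_two_mul, Real.cos_sq_arctan, one_add_inradius_div_sq hr hx hy]
  field_simp
  ring

theorem faceAngle_mono_right {y' : ℝ} (hr : 0 < r) (hx : 0 < x) (hy : 0 < y) (hyy' : y ≤ y') :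
    faceAngle r x y ≤ faceAngle r x y' := by
  have hmono : r * x * y / (r + x + y) ≤ r * x * y' / (r + x + y') := by
    have := hy.trans_le hyy'
    rw [div_le_div_iff₀ (by positivity) (by positivity)]
    nlinarith [mul_le_mul_of_nonneg_left hyy' (mul_pos (mul_pos hr hx) (add_pos hr hx)).le]
  unfold faceAngle inradius
  gcongr

section InnerProduct

variable {E : Type*} [NormedAddCommGroup E] [InnerProductSpace ℝ E]

theorem angle_eq_arccos (a b : E) : InnerProductGeometry.angle a b =
    Real.arccos ((‖a‖ ^ 2 + ‖b‖ ^ 2 - ‖a - b‖ ^ 2) / (2 * (‖a‖ * ‖b‖))) := by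
  rw [InnerProductGeometry.angle,
    real_inner_eq_norm_mul_self_add_norm_mul_self_sub_norm_sub_mul_self_div_two, div_div]
  simp only [pow_two]

variable {a b : E}

theorem angle_eq_faceAngle (hr : 0 < r) (hx : 0 < x) (hy : 0 < y) (ha : ‖a‖ = r + x)
    (hb : ‖b‖ = r + y) (hab : ‖a - b‖ = x + y) :
    InnerProductGeometry.angle a b = faceAngle r x y := by
  rw [angle_eq_arccos, ha, hb, hab, ← cos_faceAngle hr hx hy,
    Real.arccos_cos (faceAngle_pos hr hx hy).le (faceAngle_lt_pi r x y).le]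

theorem faceAngle_le_angle (hr : 0 < r) (hx : 0 < x) (hy : 0 < y) (ha : ‖a‖ = r + x)
    (hb : ‖b‖ = r + y) (hab : x + y ≤ ‖a - b‖) :
    faceAngle r x y ≤ InnerProductGeometry.angle a b := by
  rw [angle_eq_arccos, ha, hb, ← Real.arccos_cos (faceAngle_pos hr hx hy).le
    (faceAngle_lt_pi r x y).le, cos_faceAngle hr hx hy]
  exact Real.arccos_le_arccos (by gcongr)

end InnerProduct

theorem eq_mul_exp_angle {a b : ℂ} (hab : 0 < ((starRingEnd ℂ) a * b).im) :
    b = a * (‖b‖ / ‖a‖ : ℝ) * Complex.exp (InnerProductGeometry.angle a b * Complex.I) := by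
  have ha : a ≠ 0 := by rintro rfl; simp at hab
  have hb : b ≠ 0 := by rintro rfl; simp at hab
  have him : 0 ≤ (b / a).im := by
    rw [div_eq_inv_mul, Complex.inv_def, mul_right_comm, Complex.im_mul_ofReal]
    exact mul_nonneg hab.le (inv_nonneg.2 (Complex.normSq_nonneg a))
  rw [InnerProductGeometry.angle_comm, Complex.angle_eq_abs_arg hb ha,
    abs_of_nonneg (Complex.arg_nonneg_iff.2 him), ← norm_div, mul_assoc,
    Complex.norm_mul_exp_arg_mul_I, mul_div_cancel₀ _ ha]

theorem angle_le_abs_of_eq_mul_exp {a b : ℂ} (ha : a ≠ 0) {t β : ℝ} (ht : 0 < t)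
    (hab : b = a * t * Complex.exp (β * Complex.I)) : InnerProductGeometry.angle a b ≤ |β| := by
  rcases le_or_gt Real.pi |β| with hβ | hβ
  · exact (InnerProductGeometry.angle_le_pi a b).trans hβ
  have hb : b ≠ 0 := by
    rw [hab]
    exact mul_ne_zero (mul_ne_zero ha (Complex.ofReal_ne_zero.2 ht.ne')) (Complex.exp_ne_zero _)
  have hβ' : β ∈ Set.Ioc (-Real.pi) (-Real.pi + 2 * Real.pi) :=
    ⟨(abs_lt.1 hβ).1, by linarith [(abs_lt.1 hβ).2]⟩
  rw [InnerProductGeometry.angle_comm, Complex.angle_eq_abs_arg hb ha, hab, mul_assoc,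
    mul_div_cancel_left₀ _ ha, Complex.arg_real_mul _ ht, Complex.arg_exp_mul_I,
    (toIocMod_eq_self Real.two_pi_pos).2 hβ']

end FaceGeometry

/-! ### Circle packings -/

theorem two_pi_le_of_exp_mul_I_eq_one {θ : ℝ} (hθ : 0 < θ)
    (h : Complex.exp (θ * Complex.I) = 1) : 2 * Real.pi ≤ θ := by
  by_contra! hlt
  have hcos : Real.cos θ = 1 := by rw [← Complex.exp_ofReal_mul_I_re, h, Complex.one_re]
  exact hθ.ne' <| (Real.cos_eq_one_iff_of_lt_of_lt (by linarith [Real.pi_pos]) hlt).1 hcos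

namespace OrientedTriangulation

variable {V : Type*} (K : OrientedTriangulation V)

variable {K} in
theorem pos_rotate_iff {u v w : V} : K.pos u v w ↔ K.pos v w u :=
  ⟨K.pos_rotate u v w, fun h => K.pos_rotate _ _ _ (K.pos_rotate _ _ _ h)⟩

theorem pos_unique {u v w x : V} (h : K.pos u v w) (h' : K.pos u v x) : w = x := by
  obtain ⟨n, -, c, hc, hcyc⟩ := K.link_cycle u
  obtain ⟨i, rfl, rfl⟩ := (hcyc v w).1 h
  obtain ⟨j, hij, rfl⟩ := (hcyc _ x).1 h'
  rw [hc hij]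

theorem exists_fan {v u : V} (hu : K.skeleton.Adj v u) : ∃ n : ℕ, n ≠ 0 ∧ ∃ w : ℕ → V,
    w 0 = u ∧ w n = u ∧ (∀ k, K.pos v (w k) (w (k + 1))) ∧
      Set.BijOn (fun k => (w k, w (k + 1))) (Finset.range n) {e | K.pos v e.1 e.2} := by
  obtain ⟨x, hx⟩ := hu
  obtain ⟨n, hn, c, hc, hcyc⟩ := K.link_cycle v
  obtain ⟨s, rfl, -⟩ := (hcyc u x).1 hx
  have : NeZero n := ⟨by omega⟩
  have hfan : ∀ k : ℕ, K.pos v (c (s + k)) (c (s + (k + 1 : ℕ))) := fun k =>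
    (hcyc _ _).2 ⟨s + k, rfl, by rw [Nat.cast_add_one, add_assoc]⟩
  refine ⟨n, NeZero.ne n, fun k => c (s + k), by simp, by simp, hfan, fun k _ => hfan k,
    fun k hk l hl hkl => ?_, fun e he => ?_⟩
  · have hcast : (k : ZMod n) = l := add_left_cancel (hc (Prod.ext_iff.1 hkl).1)
    rw [← ZMod.val_cast_of_lt (Finset.mem_range.1 hk), hcast,
      ZMod.val_cast_of_lt (Finset.mem_range.1 hl)]
  · obtain ⟨i, h₁, h₂⟩ := (hcyc e.1 e.2).1 he
    refine ⟨(i - s).val, Finset.mem_coe.2 (Finset.mem_range.2 (ZMod.val_lt _)), Prod.ext ?_ ?_⟩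
    · simp [h₁]
    · simp [h₂, ← add_assoc]

theorem finite_setOf_pos (v : V) : {e : V × V | K.pos v e.1 e.2}.Finite := by
  obtain ⟨u, hu⟩ := K.neighborSet_nonempty v
  obtain ⟨n, -, w, -, -, -, hbij⟩ := K.exists_fan hu
  exact hbij.image_eq ▸ (Finset.finite_toSet _).image _

/-- The faces at a vertex, each recorded as its opposite positively oriented edge. -/
noncomputable def corners (v : V) : Finset (V × V) := (K.finite_setOf_pos v).toFinset

theorem mem_corners {v : V} {e : V × V} : e ∈ K.corners v ↔ K.pos v e.1 e.2 := by
  rw [corners, Set.Finite.mem_toFinset, Set.mem_ofPred_eq]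

theorem finsum_finsum_pos_mul (v : V) (f : V → V → ℝ) (g : V → ℝ) :
    ∑ᶠ w, (∑ᶠ x ∈ {x | K.pos v w x}, f w x) * g w =
      ∑ e ∈ K.corners v, f e.1 e.2 * g e.1 := by
  rw [← finsum_mem_finset_eq_sum, finsum_mem_finset_product]
  simp only [mem_corners]
  exact finsum_congr fun w => finsum_mem_mul _ _

theorem finsum_finsum_pos_swap_mul (v : V) (f : V → V → ℝ) (g : V → ℝ) :
    ∑ᶠ w, (∑ᶠ x ∈ {x | K.pos v x w}, f w x) * g w =
      ∑ e ∈ K.corners v, f e.2 e.1 * g e.2 := by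
  have hmap : ∑ e ∈ K.corners v, f e.2 e.1 * g e.2 =
      ∑ e ∈ (K.corners v).map (Equiv.prodComm V V).toEmbedding, f e.1 e.2 * g e.1 := by
    rw [Finset.sum_map]
    rfl
  rw [hmap, ← finsum_mem_finset_eq_sum, finsum_mem_finset_product]
  simp only [Finset.mem_map_equiv, Equiv.prodComm_symm, Equiv.prodComm_apply,
    Prod.swap_prod_mk, mem_corners]
  exact finsum_congr fun w => finsum_mem_mul _ _

end OrientedTriangulation

namespace CirclePacking

variable {V : Type*} {K : OrientedTriangulation V}

/-- The circles of any two neighbours of a common vertex have disjoint interiors, i.e. the packing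
is not branched at any vertex. -/
def LocallyUnivalent (P : CirclePacking K) : Prop :=
  ∀ v u w, K.skeleton.Adj v u → K.skeleton.Adj v w → u ≠ w →
    Disjoint (Metric.ball (P.center u) (P.radius u)) (Metric.ball (P.center w) (P.radius w))

theorem Univalent.locallyUnivalent {P : CirclePacking K} (hP : P.Univalent) :
    P.LocallyUnivalent := fun _ u w _ _ huw => hP u w huw

section AngleSum

variable (P : CirclePacking K)

theorem norm_center_sub {v w : V} (h : K.skeleton.Adj v w) :
    ‖P.center w - P.center v‖ = P.radius v + P.radius w := by
  obtain ⟨x, hx⟩ := h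
  rw [← dist_eq_norm, dist_comm, P.tangent v w x hx]

theorem center_sub_ne_zero {v w : V} (h : K.skeleton.Adj v w) :
    P.center w - P.center v ≠ 0 := by
  rw [← norm_pos_iff, P.norm_center_sub h]
  exact add_pos (P.radius_pos v) (P.radius_pos w)

theorem center_sub_eq_mul_exp {u v w : V} (h : K.pos u v w) :
    P.center w - P.center u = (P.center v - P.center u) *
      ((P.radius u + P.radius w) / (P.radius u + P.radius v) : ℝ) *
      Complex.exp (faceAngle (P.radius u) (P.radius v) (P.radius w) * Complex.I) := by
  have hv := P.norm_center_sub ⟨w, h⟩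
  have hw := P.norm_center_sub (K.skeleton.adj_symm ⟨v, OrientedTriangulation.pos_rotate_iff.2 h⟩)
  have hvw : ‖(P.center v - P.center u) - (P.center w - P.center u)‖ =
      P.radius v + P.radius w := by
    rw [sub_sub_sub_cancel_right, ← dist_eq_norm, P.tangent v w u (K.pos_rotate _ _ _ h)]
  rw [← angle_eq_faceAngle (P.radius_pos u) (P.radius_pos v) (P.radius_pos w) hv hw hvw,
    ← hv, ← hw]
  exact eq_mul_exp_angle (P.oriented u v w h)

/-- The total angle at the centre of `v` over the first `k` faces of a fan `w 0, w 1, …`. -/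
noncomputable def fanAngle (v : V) (w : ℕ → V) (k : ℕ) : ℝ :=
  ∑ j ∈ Finset.range k, faceAngle (P.radius v) (P.radius (w j)) (P.radius (w (j + 1)))

theorem fanAngle_zero (v : V) (w : ℕ → V) : P.fanAngle v w 0 = 0 := Finset.sum_range_zero _

theorem fanAngle_succ (v : V) (w : ℕ → V) (k : ℕ) : P.fanAngle v w (k + 1) =
    P.fanAngle v w k + faceAngle (P.radius v) (P.radius (w k)) (P.radius (w (k + 1))) :=
  Finset.sum_range_succ _ _

theorem fanAngle_pos (v : V) (w : ℕ → V) {k : ℕ} (hk : k ≠ 0) : 0 < P.fanAngle v w k :=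
  Finset.sum_pos (fun _ _ => faceAngle_pos (P.radius_pos _) (P.radius_pos _) (P.radius_pos _))
    (Finset.nonempty_range_iff.2 hk)

variable {v : V} {w : ℕ → V}

theorem center_fan_sub (hw : ∀ k, K.pos v (w k) (w (k + 1))) (k : ℕ) :
    P.center (w k) - P.center v = (P.center (w 0) - P.center v) *
      ((P.radius v + P.radius (w k)) / (P.radius v + P.radius (w 0)) : ℝ) *
      Complex.exp (P.fanAngle v w k * Complex.I) := by
  have hne : ∀ k, (P.radius v : ℂ) + P.radius (w k) ≠ 0 := fun k => by
    exact_mod_cast (add_pos (P.radius_pos v) (P.radius_pos (w k))).ne'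
  induction k with
  | zero => simp [fanAngle_zero, div_self (hne 0)]
  | succ k ih =>
    rw [P.center_sub_eq_mul_exp (hw k), ih, fanAngle_succ]
    have h0 := hne 0
    have hk := hne k
    push_cast
    rw [add_mul, Complex.exp_add]
    field_simp

theorem center_sub_fan (hw : ∀ k, K.pos v (w k) (w (k + 1))) (k : ℕ) :
    P.center (w 0) - P.center v = (P.center (w k) - P.center v) *
      ((P.radius v + P.radius (w 0)) / (P.radius v + P.radius (w k)) : ℝ) *
      Complex.exp ((2 * Real.pi - P.fanAngle v w k : ℝ) * Complex.I) := by
  have hne : ∀ k, (P.radius v : ℂ) + P.radius (w k) ≠ 0 := fun k => by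
    exact_mod_cast (add_pos (P.radius_pos v) (P.radius_pos (w k))).ne'
  have h0 := hne 0
  have hk := hne k
  have hexp : Complex.exp ((2 * Real.pi - P.fanAngle v w k : ℝ) * Complex.I) =
      (Complex.exp (P.fanAngle v w k * Complex.I))⁻¹ := by
    push_cast
    rw [sub_mul, Complex.exp_sub, Complex.exp_two_pi_mul_I, one_div]
  rw [P.center_fan_sub hw k, hexp]
  push_cast
  field_simp

theorem two_pi_le_fanAngle (hw : ∀ k, K.pos v (w k) (w (k + 1))) {n : ℕ} (hn : n ≠ 0)
    (hclose : w n = w 0) : 2 * Real.pi ≤ P.fanAngle v w n := by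
  have h := P.center_fan_sub hw n
  rw [hclose, div_self (add_pos (P.radius_pos v) (P.radius_pos (w 0))).ne', Complex.ofReal_one,
    mul_one] at h
  exact two_pi_le_of_exp_mul_I_eq_one (P.fanAngle_pos v w hn)
    ((mul_eq_left₀ (P.center_sub_ne_zero ⟨_, hw 0⟩)).1 h.symm)

variable {P}

-- Disjointness makes the angle between the rays to `w k` and `w 0` at least that of two tangent
-- neighbours of the same radii, and shrinking `w 0` to `w (k + 1)` can only decrease the latter.
theorem LocallyUnivalent.fanAngle_succ_le_two_pi (hP : P.LocallyUnivalent)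
    (hw : ∀ k, K.pos v (w k) (w (k + 1))) {k : ℕ} (hk : w k ≠ w 0)
    (hmax : P.radius (w (k + 1)) ≤ P.radius (w 0)) (hle : P.fanAngle v w k ≤ 2 * Real.pi) :
    P.fanAngle v w (k + 1) ≤ 2 * Real.pi := by
  have hv := P.radius_pos v
  have hr := fun j => P.radius_pos (w j)
  have hadj : ∀ j, K.skeleton.Adj v (w j) := fun j => ⟨_, hw j⟩
  have hdist := (disjoint_ball_ball_iff (hr k) (hr 0)).1 (hP v _ _ (hadj k) (hadj 0) hk)
  rw [dist_eq_norm, ← sub_sub_sub_cancel_right _ _ (P.center v)] at hdist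
  calc P.fanAngle v w (k + 1)
      ≤ P.fanAngle v w k + faceAngle (P.radius v) (P.radius (w k)) (P.radius (w 0)) := by
        rw [fanAngle_succ]
        gcongr
        exact faceAngle_mono_right hv (hr k) (hr (k + 1)) hmax
    _ ≤ P.fanAngle v w k + InnerProductGeometry.angle
          (P.center (w k) - P.center v) (P.center (w 0) - P.center v) := by
        gcongr
        exact faceAngle_le_angle hv (hr k) (hr 0) (P.norm_center_sub (hadj k))
          (P.norm_center_sub (hadj 0)) hdist
    _ ≤ P.fanAngle v w k + |2 * Real.pi - P.fanAngle v w k| := by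
        gcongr
        exact angle_le_abs_of_eq_mul_exp (P.center_sub_ne_zero (hadj k))
          (div_pos (add_pos hv (hr 0)) (add_pos hv (hr k))) (P.center_sub_fan hw k)
    _ = 2 * Real.pi := by rw [abs_of_nonneg (sub_nonneg.2 hle), add_sub_cancel]

theorem LocallyUnivalent.fanAngle_le_two_pi (hP : P.LocallyUnivalent)
    (hw : ∀ k, K.pos v (w k) (w (k + 1))) {n : ℕ} (hne : ∀ k < n, k ≠ 0 → w k ≠ w 0)
    (hmax : ∀ k, P.radius (w k) ≤ P.radius (w 0)) : P.fanAngle v w n ≤ 2 * Real.pi := by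
  induction n with
  | zero => rw [fanAngle_zero]; positivity
  | succ n ih =>
    rcases eq_or_ne n 0 with rfl | hn
    · rw [fanAngle_succ, fanAngle_zero, zero_add]
      linarith [faceAngle_lt_pi (P.radius v) (P.radius (w 0)) (P.radius (w 1)), Real.pi_pos]
    · exact hP.fanAngle_succ_le_two_pi hw (hne n n.lt_succ_self hn) (hmax _)
        (ih fun k hk => hne k (hk.trans n.lt_succ_self))

variable (P)

/-- The sum of the angles at the centre of `v` of the faces at `v`. -/
noncomputable def angleSum (v : V) : ℝ :=
  ∑ e ∈ K.corners v, faceAngle (P.radius v) (P.radius e.1) (P.radius e.2)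

theorem fanAngle_eq_angleSum {n : ℕ}
    (hbij : Set.BijOn (fun k => (w k, w (k + 1))) (Finset.range n) {e | K.pos v e.1 e.2}) :
    P.fanAngle v w n = P.angleSum v := by
  refine Finset.sum_nbij _ (fun k hk => K.mem_corners.2 (hbij.mapsTo hk)) hbij.injOn ?_
    fun _ _ => rfl
  rw [OrientedTriangulation.corners, Set.Finite.coe_toFinset]
  exact hbij.surjOn

theorem two_pi_le_angleSum (v : V) : 2 * Real.pi ≤ P.angleSum v := by
  obtain ⟨u, hu⟩ := K.neighborSet_nonempty v
  obtain ⟨n, hn, w, h0, hclose, hw, hbij⟩ := K.exists_fan hu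
  rw [← P.fanAngle_eq_angleSum hbij]
  exact P.two_pi_le_fanAngle hw hn (hclose.trans h0.symm)

variable {P}

theorem LocallyUnivalent.angleSum_le_two_pi (hP : P.LocallyUnivalent) (v : V) :
    P.angleSum v ≤ 2 * Real.pi := by
  obtain ⟨u, hu, hmax⟩ := Set.exists_max_image _ P.radius (K.neighborSet_finite v)
    (K.neighborSet_nonempty v)
  obtain ⟨n, hn, w, rfl, -, hw, hbij⟩ := K.exists_fan hu
  rw [← P.fanAngle_eq_angleSum hbij]
  refine hP.fanAngle_le_two_pi hw (fun k hk hk0 h => hk0 ?_) fun k => hmax _ ⟨_, hw k⟩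
  have hpair : (w k, w (k + 1)) = (w 0, w (0 + 1)) :=
    Prod.ext h (K.pos_unique (h ▸ hw k) (hw 0))
  exact hbij.injOn (Finset.mem_coe.2 (Finset.mem_range.2 hk))
    (Finset.mem_coe.2 (Finset.mem_range.2 (Nat.pos_of_ne_zero hn))) hpair

end AngleSum

section Network

variable (P : CirclePacking K)

/-- The contribution to the conductance of the edge `⟨v, w⟩` of the face on its left: the inradius
of that face divided by the length of the edge. It is `0` if there is no such face. -/
noncomputable def leftWeight (v w : V) : ℝ :=
  ∑ᶠ x ∈ {x | K.pos v w x}, edgeWeight (P.radius v) (P.radius w) (P.radius x)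

theorem leftWeight_nonneg (v w : V) : 0 ≤ P.leftWeight v w :=
  finsum_nonneg fun _ => finsum_nonneg fun _ =>
    (edgeWeight_pos (P.radius_pos _) (P.radius_pos _) (P.radius_pos _)).le

theorem leftWeight_eq {v w x : V} (h : K.pos v w x) :
    P.leftWeight v w = edgeWeight (P.radius v) (P.radius w) (P.radius x) := by
  have hx : {y | K.pos v w y} = {x} :=
    Set.eq_singleton_iff_unique_mem.2 ⟨h, fun y hy => K.pos_unique hy h⟩
  rw [leftWeight, hx, finsum_mem_singleton]

theorem leftWeight_eq_zero {v w : V} (h : ¬K.skeleton.Adj v w) : P.leftWeight v w = 0 :=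
  finsum_mem_eq_zero_of_forall_eq_zero fun x hx => (h ⟨x, hx⟩).elim

theorem leftWeight_swap (v w : V) : P.leftWeight w v =
    ∑ᶠ x ∈ {x | K.pos v x w}, edgeWeight (P.radius v) (P.radius w) (P.radius x) := by
  simp only [leftWeight, OrientedTriangulation.pos_rotate_iff (u := w),
    edgeWeight_comm (P.radius w)]

theorem leftWeight_le_half (v w : V) : P.leftWeight v w ≤ 1 / 2 := by
  by_cases h : K.skeleton.Adj v w
  · obtain ⟨x, hx⟩ := h
    rw [P.leftWeight_eq hx]
    exact edgeWeight_le_half (P.radius_pos _) (P.radius_pos _) (P.radius_pos _)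
  · rw [P.leftWeight_eq_zero h]
    norm_num

theorem leftWeight_add_leftWeight_eq_zero {v w : V} (h : ¬K.skeleton.Adj v w) :
    P.leftWeight v w + P.leftWeight w v = 0 := by
  rw [P.leftWeight_eq_zero h, P.leftWeight_eq_zero fun h' => h h'.symm, add_zero]

/-- The network on the 1-skeleton in which the conductance of an edge is the length of the dual
edge, which joins the incentres of the two faces at the edge, divided by the length of the edge. -/
noncomputable def network : Network V where
  conductance v w := P.leftWeight v w + P.leftWeight w v
  symm _ _ := add_comm _ _
  nonneg v w := add_nonneg (P.leftWeight_nonneg v w) (P.leftWeight_nonneg w v)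
  finite v := (K.neighborSet_finite v).subset fun _ hw =>
    by_contra fun h => hw (P.leftWeight_add_leftWeight_eq_zero h)

theorem network_conductance_pos {v w : V} (h : K.skeleton.Adj v w) :
    0 < P.network.conductance v w := by
  obtain ⟨x, hx⟩ := h
  refine add_pos_of_pos_of_nonneg ?_ (P.leftWeight_nonneg w v)
  rw [P.leftWeight_eq hx]
  exact edgeWeight_pos (P.radius_pos _) (P.radius_pos _) (P.radius_pos _)

theorem network_conductance_le (v w : V) :
    P.network.conductance v w ≤ K.skeletonNetwork.conductance v w := by
  by_cases h : K.skeleton.Adj v w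
  · calc P.leftWeight v w + P.leftWeight w v
        ≤ 1 / 2 + 1 / 2 := add_le_add (P.leftWeight_le_half v w) (P.leftWeight_le_half w v)
      _ = 1 := add_halves 1
      _ = K.skeletonNetwork.conductance v w := (if_pos h).symm
  · exact (P.leftWeight_add_leftWeight_eq_zero h).trans_le (K.skeletonNetwork.nonneg v w)

theorem network_laplacian (h : V → ℝ) (v : V) : P.network.laplacian h v =
    ∑ e ∈ K.corners v,
      (edgeWeight (P.radius v) (P.radius e.1) (P.radius e.2) * (h e.1 - h v) +
        edgeWeight (P.radius v) (P.radius e.2) (P.radius e.1) * (h e.2 - h v)) := by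
  have hfin : ∀ {g : V → ℝ}, (∀ w, ¬K.skeleton.Adj v w → g w = 0) →
      (fun w => g w * (h w - h v)).HasFiniteSupport := fun hg =>
    (K.neighborSet_finite v).subset fun w hw =>
      by_contra fun hvw => left_ne_zero_of_mul hw (hg w hvw)
  change ∑ᶠ w, (P.leftWeight v w + P.leftWeight w v) * (h w - h v) = _
  simp only [add_mul]
  rw [finsum_add_distrib (hfin fun _ => P.leftWeight_eq_zero)
    (hfin fun _ hw => P.leftWeight_eq_zero fun hw' => hw hw'.symm), Finset.sum_add_distrib]
  simp only [P.leftWeight_swap v]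
  congr 1
  · exact K.finsum_finsum_pos_mul v (fun w x => edgeWeight (P.radius v) (P.radius w) (P.radius x))
      fun w => h w - h v
  · exact K.finsum_finsum_pos_swap_mul v
      (fun w x => edgeWeight (P.radius v) (P.radius w) (P.radius x)) fun w => h w - h v

/-- The ratio map from `P` to `Q` at the vertices. -/
noncomputable def radiusRatio (Q : CirclePacking K) (v : V) : ℝ := Q.radius v / P.radius v

variable {P} (Q : CirclePacking K)

theorem LocallyUnivalent.laplacian_radiusRatio_nonneg (hP : P.LocallyUnivalent) (v : V) :
    0 ≤ P.network.laplacian (P.radiusRatio Q) v := by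
  have hpos : ∀ w, 0 < P.radiusRatio Q w := fun w => div_pos (Q.radius_pos w) (P.radius_pos w)
  have hmul : ∀ w, P.radiusRatio Q w * P.radius w = Q.radius w := fun w =>
    div_mul_cancel₀ _ (P.radius_pos w).ne'
  calc 0 ≤ P.radiusRatio Q v * (Q.angleSum v - P.angleSum v) :=
        mul_nonneg (hpos v).le
          (sub_nonneg.2 ((hP.angleSum_le_two_pi v).trans (Q.two_pi_le_angleSum v)))
    _ = ∑ e ∈ K.corners v, P.radiusRatio Q v *
          (faceAngle (Q.radius v) (Q.radius e.1) (Q.radius e.2) -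
            faceAngle (P.radius v) (P.radius e.1) (P.radius e.2)) := by
        rw [angleSum, angleSum, ← Finset.sum_sub_distrib, Finset.mul_sum]
    _ ≤ P.network.laplacian (P.radiusRatio Q) v := by
        rw [network_laplacian]
        gcongr with e
        simpa only [hmul] using mul_faceAngle_sub_le (P.radius_pos v) (P.radius_pos e.1)
          (P.radius_pos e.2) (hpos e.1) (hpos e.2) (hpos v)

theorem LocallyUnivalent.radiusRatio_eq (hK : K.Recurrent) (hP : P.LocallyUnivalent)
    (hQ : BddAbove (Set.range (P.radiusRatio Q))) (v w : V) :
    P.radiusRatio Q v = P.radiusRatio Q w := by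
  obtain ⟨M, hM⟩ := hQ
  have hparabolic : P.network.IsParabolic := hK.isParabolic.mono P.network_conductance_le
  have hpos : ∀ x, 0 < M + 1 - P.radiusRatio Q x := fun x => by linarith [hM ⟨x, rfl⟩]
  have hsuper : ∀ x, P.network.laplacian (fun y => M + 1 - P.radiusRatio Q y) x ≤ 0 := fun x => by
    rw [Network.laplacian_const_sub]
    exact neg_nonpos.2 (hP.laplacian_radiusRatio_nonneg Q x)
  induction K.connected v w with
  | refl => rfl
  | tail _ hxy ih =>
    exact ih.trans <| sub_right_injective <|
      hparabolic.eq_of_superharmonic hpos hsuper (P.network_conductance_pos hxy)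

end Network

section RatioMap

variable (P Q : CirclePacking K)

theorem range_radiusRatio_subset :
    Set.range (P.radiusRatio Q) ⊆ Set.range (P.ratioMap Q) := by
  classical
  rintro _ ⟨v, rfl⟩
  obtain ⟨w, x, h⟩ := K.neighborSet_nonempty v
  have hsupp : ((Finsupp.single v (1 : ℝ)).support : Set V) ⊆ {v, w, x} :=
    (Finset.coe_subset.2 Finsupp.support_single_subset).trans (by simp)
  exact ⟨⟨Finsupp.single v 1, Finsupp.single_nonneg.2 zero_le_one, by simp, v, w, x, h, hsupp⟩,
    by simp [ratioMap, radiusRatio]⟩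

variable {P Q}

theorem ratioMap_eq_of_radiusRatio_eq {c : ℝ} (hc : ∀ v, P.radiusRatio Q v = c)
    (x : K.Realization) : P.ratioMap Q x = c := by
  have hsum : ∑ v ∈ x.1.support, x.1 v = 1 := x.2.2.1
  calc P.ratioMap Q x = ∑ v ∈ x.1.support, x.1 v * P.radiusRatio Q v := rfl
    _ = c := by simp only [hc, ← Finset.sum_mul, hsum, one_mul]

end RatioMap

end CirclePacking

theorem corollary3p3_general {V : Type*} (K : OrientedTriangulation V) (hK : K.Recurrent)
    (P : CirclePacking K) (hP : P.LocallyUnivalent) (Q : CirclePacking K) :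
    ¬ BddAbove (Set.range (P.ratioMap Q)) ∨ ∃ c : ℝ, ∀ x, P.ratioMap Q x = c := by
  refine or_iff_not_imp_left.2 fun hbdd => ?_
  have hconst := hP.radiusRatio_eq Q hK ((not_not.1 hbdd).mono (P.range_radiusRatio_subset Q))
  rcases isEmpty_or_nonempty V with hV | ⟨⟨o⟩⟩
  · exact ⟨0, CirclePacking.ratioMap_eq_of_radiusRatio_eq hV.elim⟩
  · exact ⟨_, CirclePacking.ratioMap_eq_of_radiusRatio_eq fun v => hconst v o⟩

theorem corollary3p3 {V : Type*} (K : OrientedTriangulation V) (hK : K.Recurrent)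
    (P : CirclePacking K) (hP : P.Univalent) (hcarr : P.carrier = Set.univ)
    (Q : CirclePacking K) :
    ¬ BddAbove (Set.range (P.ratioMap Q)) ∨ ∃ c : ℝ, ∀ x, P.ratioMap Q x = c :=
  corollary3p3_general K hK P hP.locallyUnivalent Q
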